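/- For complex numbers $x$ and $q\neq 0$ let $q^x=\exp(x\log q)$ with the principal logarithm, and let $[x]_q=(1-q^x)/(1-q)$ if $q\neq 1$, and $[x]_1=x$. For complex numbers $a,b,q$ with $q\ne 0$ define $\mu_n(a,b,q)$, $n\ge 0$, by the expansion, as a formal power series in $z$, of the S-fraction $$\sum_{n=0}^\infty \mu_n(a,b,q)z^n=\cfrac{1}{1-\cfrac{\lambda_1z}{1-\cfrac{\lambda_2z}{1-\cdots}}},\qquad \lambda_n=\begin{cases}[nb+a]_q\,[nb-a]_q & \text{if } n \text{ is odd},\\ [nb]_q^2 & \text{if } n \text{ is even}.\end{cases}$$ (1) For all complex $a,b$, all complex $q\notin\{0,1\}$ and all $n\ge 0$, $$\mu_n(a,b,q)=\frac{1}{(1-q)^{2n}}\sum_{k=0}^n\left(\binom{2n}{n-k}-\binom{2n}{n-k-1}\right)\sum_{j=-k}^{k}(-1)^jq^{aj+b(k(k+1)-j^2)},$$ where $\binom{m}{-1}=0$. (2) For all complex $a,b$, as formal power series in $z$, $$\sum_{n=0}^\infty\mu_n(a,b,1)\frac{z^{2n}}{(2n)!}=\frac{\cos(az)}{\cos(bz)}.$$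 (3) If $0\le a<b$ and either $a,b$ are both integers or $a,b$ both lie in $\frac12+\mathbb{Z}$, then for every $n\ge0$, $\mu_n(a,b,q)$ is a polynomial in $q$ with nonnegative integer coefficients; that is, there is a polynomial $P\in\mathbb{Z}_{\geq 0}[X]$ with $\mu_n(a,b,q)=P(q)$ for all complex $q\ne0$ (including $q=1$). -/

import Mathlib

open Polynomial

noncomputable section

namespace TouchardRiordan

/-- `N`-th truncation of the tail `1/(1 - λ_m z/(1 - λ_{m+1} z/(1 - ...)))` of an S-fraction:
the partial numerators `λ_m z, ..., λ_{m+N-1} z` are kept. -/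
def sConvergent {K : Type*} [Field K] (lam : ℕ → K) : ℕ → ℕ → PowerSeries K
  | _, 0 => 1
  | m, N + 1 => (1 - PowerSeries.C (lam m) * PowerSeries.X * sConvergent lam (m + 1) N)⁻¹

/-- The tail, starting with `λ_m`, of an S-fraction, as a formal power series: the coefficient of
`z^n` in the truncations does not depend on the truncation order from order `n` on
(`coeff_sConvergent`). -/
def sTail {K : Type*} [Field K] (lam : ℕ → K) (m : ℕ) : PowerSeries K :=
  PowerSeries.mk fun n => PowerSeries.coeff n (sConvergent lam m n)

/-- The S-fraction `1/(1 - λ₁ z/(1 - λ₂ z/(1 - ...)))` of the sequence `λ₁, λ₂, ...`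
(the value `lam 0` is not used). -/
def sFraction {K : Type*} [Field K] (lam : ℕ → K) : PowerSeries K :=
  sTail lam 1

theorem constCoeff_den {K : Type*} [Field K] (c : K) (f : PowerSeries K) :
    PowerSeries.constantCoeff (1 - PowerSeries.C c * PowerSeries.X * f) = 1 := by
  simp

theorem X_pow_dvd_sConvergent_sub {K : Type*} [Field K] (lam : ℕ → K) (n : ℕ) :
    ∀ m N : ℕ, n ≤ N →
      (PowerSeries.X : PowerSeries K) ^ (n + 1) ∣ sConvergent lam m N - sConvergent lam m n := by
  induction n with
  | zero =>
    intro m N _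
    rw [zero_add, pow_one, PowerSeries.X_dvd_iff]
    cases N <;> simp [sConvergent]
  | succ n ih =>
    intro m N hN
    obtain ⟨M, rfl⟩ : ∃ M, N = M + 1 := ⟨N - 1, by omega⟩
    obtain ⟨g, hg⟩ := ih (m + 1) M (by omega)
    simp only [sConvergent]
    set A := 1 - PowerSeries.C (lam m) * PowerSeries.X * sConvergent lam (m + 1) M with hA
    set B := 1 - PowerSeries.C (lam m) * PowerSeries.X * sConvergent lam (m + 1) n with hB
    have hA1 : A * A⁻¹ = 1 :=
      PowerSeries.mul_inv_cancel _ (by rw [hA, constCoeff_den]; exact one_ne_zero)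
    have hB1 : B * B⁻¹ = 1 :=
      PowerSeries.mul_inv_cancel _ (by rw [hB, constCoeff_den]; exact one_ne_zero)
    refine ⟨A⁻¹ * B⁻¹ * PowerSeries.C (lam m) * g, ?_⟩
    have h1 : A⁻¹ - B⁻¹ = A⁻¹ * B⁻¹ * (B - A) := by
      linear_combination (-A⁻¹) * hB1 + B⁻¹ * hA1
    have h2 : B - A = PowerSeries.C (lam m) * PowerSeries.X * (PowerSeries.X ^ (n + 1) * g) := by
      rw [← hg, hA, hB]; ring
    rw [h1, h2]; ring

theorem coeff_sConvergent {K : Type*} [Field K] (lam : ℕ → K) (m n N : ℕ) (h : n ≤ N) :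
    PowerSeries.coeff n (sConvergent lam m N) = PowerSeries.coeff n (sTail lam m) := by
  have := (PowerSeries.X_pow_dvd_iff.1 (X_pow_dvd_sConvergent_sub lam n m N h)) n (by omega)
  rw [map_sub, sub_eq_zero] at this
  rw [this, sTail, PowerSeries.coeff_mk]

/-- The recursion that the continued fraction notation stands for. -/
theorem sTail_eq {K : Type*} [Field K] (lam : ℕ → K) (m : ℕ) :
    sTail lam m = (1 - PowerSeries.C (lam m) * PowerSeries.X * sTail lam (m + 1))⁻¹ := by
  rw [PowerSeries.eq_inv_iff_mul_eq_one (by rw [constCoeff_den]; exact one_ne_zero)]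
  ext n
  have hA1 : sConvergent lam m (n + 1) *
      (1 - PowerSeries.C (lam m) * PowerSeries.X * sConvergent lam (m + 1) n) = 1 := by
    simp only [sConvergent]
    exact PowerSeries.inv_mul_cancel _ (by rw [constCoeff_den]; exact one_ne_zero)
  conv_rhs => rw [← hA1]
  rw [PowerSeries.coeff_mul, PowerSeries.coeff_mul]
  refine Finset.sum_congr rfl fun p hp => ?_
  have hp' := Finset.HasAntidiagonal.mem_antidiagonal.1 hp
  rw [coeff_sConvergent lam m p.1 (n + 1) (by omega)]
  congr 1
  rw [map_sub, map_sub, mul_assoc, mul_assoc, PowerSeries.coeff_C_mul, PowerSeries.coeff_C_mul]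
  congr 2
  obtain ⟨i, t⟩ := p
  dsimp only at hp' ⊢
  rcases t with _ | s
  · simp
  · rw [PowerSeries.coeff_succ_X_mul, PowerSeries.coeff_succ_X_mul,
      coeff_sConvergent lam (m + 1) s n (by omega)]

/-- `[x]_q = (1 - q^x)/(1 - q)` for an arbitrary number `x`, with `[x]_1 = x`; here
`q^x = exp (x log q)` with the principal logarithm. -/
def qNum (q x : ℂ) : ℂ :=
  if q = 1 then x else (1 - q ^ x) / (1 - q)

/-- The value `[x]_1 = x` is the limit of `[x]_q` as `q` tends to `1`. -/
theorem tendsto_qNum (x : ℂ) :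
    Filter.Tendsto (fun q => qNum q x) (nhdsWithin 1 {1}ᶜ) (nhds x) := by
  have h : HasDerivAt (fun q : ℂ => q ^ x) x 1 := by
    simpa using (hasDerivAt_id (1 : ℂ)).cpow_const (c := x) (by simp)
  refine (hasDerivAt_iff_tendsto_slope.1 h).congr' ?_
  filter_upwards [self_mem_nhdsWithin] with q hq
  have hq1 : q ≠ 1 := hq
  rw [slope_def_field, qNum, if_neg hq1, Complex.one_cpow, ← neg_sub (q ^ x), ← neg_sub q,
    neg_div_neg_eq]

/-- `λ_n = [nb+a]_q [nb-a]_q` for odd `n` and `λ_n = [nb]_q^2` for even `n`. -/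
def lamSeq (a b q : ℂ) (n : ℕ) : ℂ :=
  if Odd n then qNum q (n * b + a) * qNum q (n * b - a) else qNum q (n * b) ^ 2

/-- `μ_n(a,b,q)`, the coefficient of `z^n` in the S-fraction of `λ`. -/
def mu (a b q : ℂ) (n : ℕ) : ℂ :=
  PowerSeries.coeff n (sFraction (lamSeq a b q))

/-- The binomial coefficient with an integer lower index; it vanishes for a negative one. -/
def binom (n : ℕ) (k : ℤ) : ℤ :=
  if k < 0 then 0 else (n.choose k.toNat : ℤ)

end TouchardRiordan

end

/-!
The S-fraction is contracted to a J-fraction, so that `mu a b q n` is the corner entry of the `n`-th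
power of a tridiagonal operator `T` (`coeff_sFraction_eq_jacobiOp_pow`). The moments are computed in
a Newton basis of polynomials `φᵢ` instead of the monomials: if vectors `vᵢ` satisfy a two-term rule
`T vᵢ = c i • vᵢ₊₁ + d i • vᵢ`, then `T ^ n v₀` is a combination of the `vᵢ` whose coefficients
depend on `c` and `d` alone (`pow_apply_eq_sum_connCoeff`).

For `q ≠ 1` put `α = q ^ a`, `β = q ^ b`, `p = β ^ 2`. The orthogonal polynomials are continuous dual
`q`-Hahn polynomials, and with `φᵢ = ∏_{l < i} ((1 - p ^ l) ^ 2 + p ^ l * X)` the vectors `vᵢ` are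
explicit products (`jacobiOp_qHahn`), with corner entry
`∏_{l < i} (1 - β * α * p ^ l) * (1 - β * α⁻¹ * p ^ l)`. The operator of the constant S-fraction
`1, 1, 1, …`, whose moments are the ballot numbers, admits vectors `laurentCoeff β i` with the same
`c` and `d` (`jacobiOp_laurentCoeff`). Hence ballot numbers and moments have the same expansion
coefficients, and the closed formula reduces to an identity for each `i`, which is a summation by
parts of the finite Jacobi triple product (`sum_laurentCoeff`). Gaussian binomial coefficients are
defined by the Pascal rule and never divided by, so roots of unity need no separate treatment.

At `q = 1` the Newton basis is `∏_{l < i} (X + (2 l b) ^ 2)`. Its dual basis, with `X` acting as the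
second derivative, consists of the series `(sin (b z) / b) ^ (2 i) / (2 i)!` (`coeff_sinPow`), and the
generating function is the expansion of `cos (a z) / cos (b z)` in these series. That expansion
follows from the equation `y'' = -a ^ 2 * y` for its product with `cos (b z)`, where the sum
telescopes (`derivative_derivative_cosSeries_mul_secPartialSum`).

Under the integrality hypotheses the partial numerators `lamSeq a b q n`, `n ≥ 1`, are products of two
numbers `[m]_q` with `m` a natural number, and the coefficients of an S-fraction are polynomials with
nonnegative integer coefficients in its partial numerators (`exists_coeff_sTail_eq_eval`).
-/

noncomputable section

namespace TouchardRiordan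

/-! ### S-fractions and tridiagonal operators -/

section SFraction

variable {K : Type*} [Field K]

theorem sTail_eq_one_add (lam : ℕ → K) (m : ℕ) :
    sTail lam m =
      1 + PowerSeries.C (lam m) * PowerSeries.X * sTail lam m * sTail lam (m + 1) := by
  have h : sTail lam m *
      (1 - PowerSeries.C (lam m) * PowerSeries.X * sTail lam (m + 1)) = 1 := by
    rw [← PowerSeries.eq_inv_iff_mul_eq_one (by rw [constCoeff_den]; exact one_ne_zero)]
    exact sTail_eq lam m
  linear_combination h

theorem coeff_zero_sTail (lam : ℕ → K) (m : ℕ) :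
    PowerSeries.coeff 0 (sTail lam m) = 1 := by
  rw [sTail_eq_one_add]
  simp

theorem coeff_succ_sTail (lam : ℕ → K) (m n : ℕ) :
    PowerSeries.coeff (n + 1) (sTail lam m) =
      lam m * ∑ ij ∈ Finset.HasAntidiagonal.antidiagonal n,
        PowerSeries.coeff ij.1 (sTail lam m) * PowerSeries.coeff ij.2 (sTail lam (m + 1)) := by
  conv_lhs => rw [sTail_eq_one_add]
  have h : PowerSeries.C (lam m) * PowerSeries.X * sTail lam m * sTail lam (m + 1) =
      PowerSeries.C (lam m) * (PowerSeries.X * (sTail lam m * sTail lam (m + 1))) := by ring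
  rw [map_add, h, PowerSeries.coeff_C_mul, PowerSeries.coeff_succ_X_mul, PowerSeries.coeff_mul,
    PowerSeries.coeff_one, if_neg (Nat.succ_ne_zero n), zero_add]

/-- Scaling all partial numerators by `r` scales the `n`-th coefficient by `r ^ n`. -/
theorem coeff_sTail_const_mul (r : K) (lam : ℕ → K) (n : ℕ) : ∀ m : ℕ,
    PowerSeries.coeff n (sTail (fun i => r * lam i) m) =
      r ^ n * PowerSeries.coeff n (sTail lam m) := by
  induction n using Nat.strong_induction_on with
  | _ n ih =>
    intro m
    rcases n with _ | n
    · simp [coeff_zero_sTail]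
    · rw [coeff_succ_sTail, coeff_succ_sTail, Finset.mul_sum, Finset.mul_sum, Finset.mul_sum]
      refine Finset.sum_congr rfl fun ij hij => ?_
      have h := Finset.HasAntidiagonal.mem_antidiagonal.1 hij
      rw [ih ij.1 (by omega), ih ij.2 (by omega), pow_succ, ← h, pow_add]
      ring

/-- The operator on sequences whose powers count weighted Motzkin paths: up steps have weight `1`,
level steps at height `m` weight `A m + C m`, down steps from height `m + 1` weight
`A m * C (m + 1)`. These are the coefficients of the J-fraction that is the even part of the
S-fraction of the sequence `A 0, C 1, A 1, C 2, …`. -/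
def jacobiOp (A C : ℕ → K) : (ℕ → K) →ₗ[K] (ℕ → K) where
  toFun v m := (if m = 0 then 0 else v (m - 1)) + (A m + C m) * v m + A m * C (m + 1) * v (m + 1)
  map_add' v w := by
    funext m
    simp only [Pi.add_apply]
    split_ifs <;> ring
  map_smul' r v := by
    funext m
    simp only [Pi.smul_apply, smul_eq_mul, RingHom.id_apply]
    split_ifs <;> ring

theorem jacobiOp_zero (A C : ℕ → K) (v : ℕ → K) :
    jacobiOp A C v 0 = (A 0 + C 0) * v 0 + A 0 * C 1 * v 1 := by
  simp [jacobiOp]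

theorem jacobiOp_succ (A C : ℕ → K) (v : ℕ → K) (m : ℕ) :
    jacobiOp A C v (m + 1) =
      v m + (A (m + 1) + C (m + 1)) * v (m + 1) + A (m + 1) * C (m + 2) * v (m + 2) := by
  simp [jacobiOp]

/-- The product of the first `m + 1` tails of an S-fraction. It is, up to a power of the variable,
the generating function of the weighted Dyck prefixes that end at height `m`. -/
def tailProd (lam : ℕ → K) (m : ℕ) : PowerSeries K :=
  ∏ l ∈ Finset.range (m + 1), sTail lam (l + 1)

theorem tailProd_zero (lam : ℕ → K) :
    tailProd lam 0 = 1 + PowerSeries.C (lam 1) * PowerSeries.X * tailProd lam 1 := by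
  have h := sTail_eq_one_add lam 1
  simp only [tailProd, Finset.prod_range_succ, Finset.prod_range_zero, one_mul, zero_add]
  linear_combination h

theorem tailProd_succ (lam : ℕ → K) (m : ℕ) :
    tailProd lam (m + 1) =
      tailProd lam m + PowerSeries.C (lam (m + 2)) * PowerSeries.X * tailProd lam (m + 2) := by
  have h := sTail_eq_one_add lam (m + 2)
  have h1 : tailProd lam (m + 1) = tailProd lam m * sTail lam (m + 2) :=
    Finset.prod_range_succ _ _
  have h2 : tailProd lam (m + 2) = tailProd lam (m + 1) * sTail lam (m + 3) :=
    Finset.prod_range_succ _ _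
  rw [h2, h1]
  linear_combination tailProd lam m * h

theorem coeff_zero_tailProd (lam : ℕ → K) (m : ℕ) :
    PowerSeries.coeff 0 (tailProd lam m) = 1 := by
  rw [PowerSeries.coeff_zero_eq_constantCoeff_apply, tailProd, map_prod]
  refine Finset.prod_eq_one fun l _ => ?_
  rw [← PowerSeries.coeff_zero_eq_constantCoeff_apply, coeff_zero_sTail]

/-- Contraction of an S-fraction to a J-fraction: the coefficients of the S-fraction are the
moments of the tridiagonal operator. The value `lam 0`, which the fraction does not see, has to
vanish because `jacobiOp` uses it as a summand of its first diagonal entry. -/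
theorem coeff_sFraction_eq_jacobiOp_pow (lam : ℕ → K) (h0 : lam 0 = 0) (n : ℕ) :
    PowerSeries.coeff n (sFraction lam) =
      ((jacobiOp (fun m => lam (2 * m + 1)) (fun m => lam (2 * m))) ^ n) (Pi.single 0 1) 0 := by
  set T := jacobiOp (fun m => lam (2 * m + 1)) (fun m => lam (2 * m)) with hT
  have key : ∀ n, (T ^ n) (Pi.single 0 1) =
      fun m => PowerSeries.coeff n (PowerSeries.X ^ m * tailProd lam (2 * m)) := by
    intro n
    induction n with
    | zero =>
      funext m
      rcases m with _ | m
      · have := coeff_zero_tailProd lam 0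
        simpa using this.symm
      · simp
    | succ n ih =>
      rw [pow_succ', Module.End.mul_apply, ih]
      funext m
      rcases m with _ | m
      · have h : PowerSeries.X ^ 0 * tailProd lam (2 * 0) = 1 + PowerSeries.X *
            (PowerSeries.C (lam 1) * (PowerSeries.X ^ 0 * tailProd lam (2 * 0)) +
              PowerSeries.C (lam 1 * lam 2) * (PowerSeries.X ^ 1 * tailProd lam (2 * 1))) := by
          have h1 := tailProd_zero lam
          have h2 := tailProd_succ lam 0
          rw [map_mul]
          norm_num at h1 h2 ⊢
          linear_combination h1 + PowerSeries.C (lam 1) * PowerSeries.X * h2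
        rw [h, map_add, PowerSeries.coeff_succ_X_mul, PowerSeries.coeff_one,
          if_neg (Nat.succ_ne_zero n), hT, jacobiOp_zero, map_add, PowerSeries.coeff_C_mul,
          PowerSeries.coeff_C_mul]
        simp [h0]
      · have h : PowerSeries.X ^ (m + 1) * tailProd lam (2 * (m + 1)) = PowerSeries.X *
            (PowerSeries.X ^ m * tailProd lam (2 * m) +
              PowerSeries.C (lam (2 * m + 3) + lam (2 * m + 2)) *
                (PowerSeries.X ^ (m + 1) * tailProd lam (2 * (m + 1))) +
              PowerSeries.C (lam (2 * m + 3) * lam (2 * m + 4)) *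
                (PowerSeries.X ^ (m + 2) * tailProd lam (2 * (m + 2)))) := by
          have h1 := tailProd_succ lam (2 * m)
          have h2 := tailProd_succ lam (2 * m + 1)
          have h3 := tailProd_succ lam (2 * m + 2)
          rw [map_mul, map_add, show 2 * (m + 1) = 2 * m + 2 by ring,
            show 2 * (m + 2) = 2 * m + 4 by ring]
          simp only [add_assoc, Nat.reduceAdd] at h1 h2 h3 ⊢
          linear_combination PowerSeries.X ^ (m + 1) * (h1 + h2) +
            PowerSeries.C (lam (2 * m + 3)) * PowerSeries.X ^ (m + 2) * h3
        rw [h, PowerSeries.coeff_succ_X_mul, hT, jacobiOp_succ, map_add, map_add,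
          PowerSeries.coeff_C_mul, PowerSeries.coeff_C_mul]
        rfl
  rw [key]
  simp [tailProd, sFraction]

/-- The coefficients of `T ^ n v₀` in terms of a sequence of vectors with
`T vᵢ = c i vᵢ₊₁ + d i vᵢ`. -/
def connCoeff (c d : ℕ → K) : ℕ → ℕ → K
  | 0, i => if i = 0 then 1 else 0
  | n + 1, 0 => d 0 * connCoeff c d n 0
  | n + 1, i + 1 => c i * connCoeff c d n i + d (i + 1) * connCoeff c d n (i + 1)

theorem connCoeff_eq_zero (c d : ℕ → K) (n : ℕ) : ∀ i, n < i → connCoeff c d n i = 0 := by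
  induction n with
  | zero =>
    intro i hi
    simp [connCoeff, Nat.pos_iff_ne_zero.1 hi]
  | succ n ih =>
    intro i hi
    obtain ⟨i, rfl⟩ : ∃ j, i = j + 1 := ⟨i - 1, by omega⟩
    simp [connCoeff, ih i (by omega), ih (i + 1) (by omega)]

theorem pow_apply_eq_sum_connCoeff {M : Type*} [AddCommGroup M] [Module K M] (T : M →ₗ[K] M)
    (c d : ℕ → K) (v : ℕ → M) (hv : ∀ i, T (v i) = c i • v (i + 1) + d i • v i) (n : ℕ) :
    (T ^ n) (v 0) = ∑ i ∈ Finset.range (n + 1), connCoeff c d n i • v i := by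
  induction n with
  | zero => simp [connCoeff]
  | succ n ih =>
    rw [pow_succ', Module.End.mul_apply, ih, map_sum]
    simp only [map_smul, hv, smul_add, smul_smul, Finset.sum_add_distrib]
    rw [Finset.sum_range_succ' (fun i => connCoeff c d (n + 1) i • v i)]
    simp only [connCoeff, add_smul, Finset.sum_add_distrib]
    rw [add_assoc]
    congr 1
    · exact Finset.sum_congr rfl fun i _ => by rw [mul_comm]
    · rw [Finset.sum_range_succ (fun i => (d (i + 1) * connCoeff c d n (i + 1)) • v (i + 1)),
        connCoeff_eq_zero c d n (n + 1) (Nat.lt_succ_self n), mul_zero, zero_smul, add_zero,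
        Finset.sum_range_succ']
      simp only [mul_comm]

/-- Product-type vectors `w i m * ∏_{m ≤ l < i} A l` are moved by `jacobiOp A C` to a combination of
two neighbours as soon as the triangular array `w` satisfies the scalar recurrences below. -/
theorem jacobiOp_mul_prod (A C c d : ℕ → K) (w : ℕ → ℕ → K)
    (hw : ∀ i m, i < m → w i m = 0)
    (hdiag : ∀ i, c i * w (i + 1) (i + 1) = w i i)
    (hzero : ∀ i, c i * w (i + 1) 0 * A i + d i * w i 0 =
      (A 0 + C 0) * w i 0 + C 1 * w i 1)
    (hsucc : ∀ i m, m < i → c i * w (i + 1) (m + 1) * A i + d i * w i (m + 1) =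
      w i m * A m + (A (m + 1) + C (m + 1)) * w i (m + 1) + C (m + 2) * w i (m + 2)) (i : ℕ) :
    jacobiOp A C (fun m => w i m * ∏ l ∈ Finset.Ico m i, A l) =
      c i • (fun m => w (i + 1) m * ∏ l ∈ Finset.Ico m (i + 1), A l) +
        d i • (fun m => w i m * ∏ l ∈ Finset.Ico m i, A l) := by
  have hdown : ∀ m, A m * (w i (m + 1) * ∏ l ∈ Finset.Ico (m + 1) i, A l) =
      w i (m + 1) * ∏ l ∈ Finset.Ico m i, A l := by
    intro m
    rcases lt_or_ge m i with h | h
    · rw [Finset.prod_eq_prod_Ico_succ_bot h]; ring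
    · rw [hw i (m + 1) (by omega)]; ring
  funext m
  simp only [Pi.add_apply, Pi.smul_apply, smul_eq_mul]
  rcases m with _ | m
  · rw [jacobiOp_zero, Finset.prod_Ico_succ_top (Nat.zero_le i)]
    linear_combination C 1 * hdown 0 - (∏ l ∈ Finset.Ico 0 i, A l) * hzero i
  · rw [jacobiOp_succ]
    rcases lt_trichotomy m i with h | h | h
    · rw [Finset.prod_Ico_succ_top (show m + 1 ≤ i from h),
        Finset.prod_eq_prod_Ico_succ_bot h]
      linear_combination C (m + 2) * hdown (m + 1) -
        (∏ l ∈ Finset.Ico (m + 1) i, A l) * hsucc i m h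
    · subst h
      simp only [hw m (m + 1) (by omega), hw m (m + 2) (by omega)]
      simp [hdiag m]
    · rw [hw i m h, hw i (m + 1) (by omega), hw i (m + 2) (by omega),
        hw (i + 1) (m + 1) (by omega)]
      ring

end SFraction

/-! ### Gaussian binomial coefficients -/

section GaussBinom

variable {K : Type*} [Field K]

/-- The Gaussian binomial coefficient `[n choose k]_p` with an integer lower index, defined by the
`p`-Pascal rule, so that it makes sense at roots of unity as well. -/
def gaussBinom (p : K) : ℕ → ℤ → K
  | 0, k => if k = 0 then 1 else 0
  | n + 1, k => gaussBinom p n (k - 1) + p ^ k * gaussBinom p n k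

theorem gaussBinom_succ (p : K) (n : ℕ) (k : ℤ) :
    gaussBinom p (n + 1) k = gaussBinom p n (k - 1) + p ^ k * gaussBinom p n k := rfl

/-- The second `p`-Pascal rule. -/
theorem gaussBinom_succ' {p : K} (hp : p ≠ 0) (n : ℕ) : ∀ k : ℤ,
    gaussBinom p (n + 1) k = p ^ ((n : ℤ) + 1 - k) * gaussBinom p n (k - 1) + gaussBinom p n k := by
  induction n with
  | zero =>
    intro k
    simp only [gaussBinom]
    rcases eq_or_ne k 0 with rfl | h0
    · simp
    · rcases eq_or_ne k 1 with rfl | h1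
      · simp
      · simp [h0, sub_eq_zero, h1]
  | succ n ih =>
    intro k
    have h1 := ih k
    have h2 := ih (k - 1)
    have h3 := gaussBinom_succ p n k
    have h4 := gaussBinom_succ p n (k - 1)
    rw [gaussBinom_succ p (n + 1)]
    have e1 : p ^ k * p ^ ((n : ℤ) + 1 - k) = p ^ ((n : ℤ) + 1) := by
      rw [← zpow_add₀ hp]; congr 1; ring
    have e2 : p ^ (((n + 1 : ℕ) : ℤ) + 1 - k) * p ^ (k - 1) = p ^ ((n : ℤ) + 1) := by
      rw [← zpow_add₀ hp]; congr 1; push_cast; ring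
    have e3 : p ^ ((n : ℤ) + 1 - (k - 1)) = p ^ (((n + 1 : ℕ) : ℤ) + 1 - k) := by
      congr 1; push_cast; ring
    rw [e3] at h2
    linear_combination h2 + p ^ k * h1 - p ^ (((n + 1 : ℕ) : ℤ) + 1 - k) * h4 - h3 +
      gaussBinom p n (k - 1) * (e1 - e2)

/-- The ratio of neighbouring coefficients, without division: the difference of the two Pascal
rules. -/
theorem one_sub_mul_gaussBinom {p : K} (hp : p ≠ 0) (n : ℕ) (k : ℤ) :
    (1 - p ^ k) * gaussBinom p n k = (1 - p ^ ((n : ℤ) + 1 - k)) * gaussBinom p n (k - 1) := by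
  linear_combination gaussBinom_succ p n k - gaussBinom_succ' hp n k

theorem gaussBinom_symm {p : K} (hp : p ≠ 0) (n : ℕ) : ∀ k : ℤ,
    gaussBinom p n k = gaussBinom p n (n - k) := by
  induction n with
  | zero => intro k; simp [gaussBinom]
  | succ n ih =>
    intro k
    rw [gaussBinom_succ, gaussBinom_succ' hp, ih k, ih (k - 1),
      show (n : ℤ) + 1 - (((n + 1 : ℕ) : ℤ) - k) = k by push_cast; ring,
      show ((n + 1 : ℕ) : ℤ) - k - 1 = n - k by push_cast; ring,
      show ((n + 1 : ℕ) : ℤ) - k = n - (k - 1) by push_cast; ring]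
    ring

theorem gaussBinom_of_neg (p : K) (n : ℕ) : ∀ k : ℤ, k < 0 → gaussBinom p n k = 0 := by
  induction n with
  | zero => intro k hk; simp [gaussBinom, hk.ne]
  | succ n ih => intro k hk; rw [gaussBinom_succ, ih k hk, ih (k - 1) (by omega)]; simp

theorem gaussBinom_of_lt (p : K) (n : ℕ) : ∀ k : ℤ, (n : ℤ) < k → gaussBinom p n k = 0 := by
  induction n with
  | zero => intro k hk; simp [gaussBinom, (show k ≠ 0 by omega)]
  | succ n ih =>
    intro k hk
    rw [gaussBinom_succ, ih k (by omega), ih (k - 1) (by omega)]; simp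

theorem gaussBinom_zero_right (p : K) (n : ℕ) : gaussBinom p n 0 = 1 := by
  induction n with
  | zero => simp [gaussBinom]
  | succ n ih => rw [gaussBinom_succ, ih, gaussBinom_of_neg p n _ (by norm_num)]; simp

theorem gaussBinom_self (p : K) (n : ℕ) : gaussBinom p n n = 1 := by
  induction n with
  | zero => simp [gaussBinom]
  | succ n ih =>
    rw [gaussBinom_succ, gaussBinom_of_lt p n ((n + 1 : ℕ) : ℤ) (by push_cast; omega), mul_zero, add_zero]
    simpa using ih

/-- At `p = 1` the Gaussian binomial coefficients are the ordinary ones. -/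
theorem gaussBinom_one (n : ℕ) : ∀ k : ℤ, gaussBinom (1 : K) n k = (binom n k : K) := by
  induction n with
  | zero =>
    intro k
    obtain hk | rfl | hk := lt_trichotomy k 0
    · simp [gaussBinom, binom, hk, hk.ne]
    · simp [gaussBinom, binom]
    · obtain ⟨m, rfl⟩ : ∃ m : ℕ, k = m + 1 := ⟨(k - 1).toNat, by omega⟩
      have h1 : ((m : ℤ) + 1).toNat = m + 1 := by omega
      simp [gaussBinom, binom, hk.not_gt, hk.ne', h1]
  | succ n ih =>
    intro k
    rw [gaussBinom_succ, ih, ih]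
    obtain hk | rfl | hk := lt_trichotomy k 0
    · simp [binom, hk, (show k - 1 < 0 by omega)]
    · simp [binom]
    · obtain ⟨m, rfl⟩ : ∃ m : ℕ, k = m + 1 := ⟨(k - 1).toNat, by omega⟩
      have h1 : ((m : ℤ) + 1).toNat = m + 1 := by omega
      simp only [binom, hk.not_gt, if_false, h1, add_sub_cancel_right, Int.toNat_natCast,
        (show ¬ (m : ℤ) < 0 by omega), Nat.choose_succ_succ]
      push_cast
      simp

/-- The `p`-Pascal rule applied twice around the central column. -/
theorem gaussBinom_add_two {p : K} (hp : p ≠ 0) (i : ℕ) (j : ℤ) :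
    gaussBinom p (2 * (i + 1)) (((i + 1 : ℕ) : ℤ) - j) =
      (1 + p ^ (2 * (i : ℤ) + 1)) * gaussBinom p (2 * i) (i - j) +
        p ^ ((i : ℤ) + 1 - j) * gaussBinom p (2 * i) (i - (j - 1)) +
        p ^ ((i : ℤ) + 1 + j) * gaussBinom p (2 * i) (i - (j + 1)) := by
  rw [show 2 * (i + 1) = 2 * i + 1 + 1 by ring, gaussBinom_succ, gaussBinom_succ' hp,
    gaussBinom_succ' hp, show ((i + 1 : ℕ) : ℤ) - j - 1 - 1 = i - (j + 1) by push_cast; ring,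
    show ((i + 1 : ℕ) : ℤ) - j - 1 = i - j by push_cast; ring,
    show ((i + 1 : ℕ) : ℤ) - j = i - (j - 1) by push_cast; ring,
    show ((2 * i : ℕ) : ℤ) + 1 - (i - j) = i + 1 + j by push_cast; ring,
    show ((2 * i : ℕ) : ℤ) + 1 - (i - (j - 1)) = i + j by push_cast; ring]
  have e1 : p ^ ((i : ℤ) - (j - 1)) = p ^ ((i : ℤ) + 1 - j) := by congr 1; ring
  have e2 : p ^ ((i : ℤ) - (j - 1)) * p ^ ((i : ℤ) + j) = p ^ (2 * (i : ℤ) + 1) := by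
    rw [← zpow_add₀ hp]; congr 1; ring
  linear_combination gaussBinom p (2 * i) (i - (j - 1)) * e1 + gaussBinom p (2 * i) (i - j) * e2

end GaussBinom

/-! ### Ladder vectors of the tridiagonal operators -/

section Ladder

variable {K : Type*} [Field K]

/-- The weight of `vᵢ₊₁` in the ladder `T vᵢ = upCoeff i • vᵢ₊₁ + diagCoeff i • vᵢ`, that is, of
`X * φᵢ = p ^ (-i) * φᵢ₊₁ - p ^ (-i) * (1 - p ^ i) ^ 2 * φᵢ` for the polynomials
`φᵢ = ∏_{l < i} ((1 - p ^ l) ^ 2 + p ^ l * X)`. -/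
def upCoeff (p : K) (i : ℕ) : K := (p ^ i)⁻¹

/-- The diagonal coefficient that goes with `upCoeff`. -/
def diagCoeff (p : K) (i : ℕ) : K := -((p ^ i)⁻¹ * (1 - p ^ i) ^ 2)

/-- The vectors formed by the coefficients of `φᵢ` in the orthogonal polynomials of the J-fraction
(continuous dual `q`-Hahn polynomials) have a product form. The parameter `u` stands for
`β * (α + α⁻¹)` with `p = β ^ 2`, so that `1 - p ^ l * u + p ^ (2 * l + 1)` is
`(1 - β ^ (2 * l + 1) * α) * (1 - β ^ (2 * l + 1) * α⁻¹)`. -/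
theorem jacobiOp_qHahn {p : K} (hp : p ≠ 0) (u : K) (i : ℕ) :
    jacobiOp (fun l => 1 - p ^ l * u + p ^ (2 * l + 1)) (fun l => (1 - p ^ l) ^ 2)
        (fun m : ℕ => (p ^ (m.choose 2) * gaussBinom p i m) *
          ∏ l ∈ Finset.Ico m i, (1 - p ^ l * u + p ^ (2 * l + 1))) =
      upCoeff p i • (fun m : ℕ => (p ^ (m.choose 2) * gaussBinom p (i + 1) m) *
          ∏ l ∈ Finset.Ico m (i + 1), (1 - p ^ l * u + p ^ (2 * l + 1))) +
        diagCoeff p i • (fun m : ℕ => (p ^ (m.choose 2) * gaussBinom p i m) *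
          ∏ l ∈ Finset.Ico m i, (1 - p ^ l * u + p ^ (2 * l + 1))) := by
  refine jacobiOp_mul_prod _ _ (upCoeff p) (diagCoeff p)
    (fun i m => p ^ (m.choose 2) * gaussBinom p i m) ?_ ?_ ?_ ?_ i
  · intro i m h
    simp [gaussBinom_of_lt p i m (by exact_mod_cast h)]
  · intro i
    have h1 := gaussBinom_self p i
    have h2 := gaussBinom_self p (i + 1)
    simp only [upCoeff, h1, h2, Nat.choose_succ_succ', Nat.choose_one_right, mul_one]
    rw [pow_add, inv_mul_cancel_left₀ (pow_ne_zero _ hp)]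
  · intro i
    have h := one_sub_mul_gaussBinom hp i 1
    simp only [zpow_one, sub_self, gaussBinom_zero_right, add_sub_cancel_right, zpow_natCast,
      mul_one] at h
    have hi : p ^ i ≠ 0 := pow_ne_zero _ hp
    simp only [upCoeff, diagCoeff, gaussBinom_zero_right, Nat.cast_one, Nat.choose_zero_succ,
      Nat.cast_zero, pow_zero, Nat.choose_succ_self, pow_one, mul_one,
      one_mul, sub_self, mul_zero, zero_add]
    field_simp
    linear_combination (-p ^ i * (1 - p)) * h
  · intro i m _
    -- With `x = p ^ m` and `y = p ^ i` the claim is linear in three neighbouring Gaussian binomial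
    -- coefficients, whose ratios `h1` and `h2` provide.
    have hi : p ^ i ≠ 0 := pow_ne_zero _ hp
    have hm : p ^ m ≠ 0 := pow_ne_zero _ hp
    have hx : p ^ ((i : ℤ) - m) = p ^ i / p ^ m := by rw [zpow_sub₀ hp]; simp
    have h0 := gaussBinom_succ p i ((m : ℤ) + 1)
    have h1 := one_sub_mul_gaussBinom hp i ((m : ℤ) + 1)
    have h2 := one_sub_mul_gaussBinom hp i ((m : ℤ) + 1 + 1)
    rw [show (i : ℤ) + 1 - (m + 1) = i - m by ring, hx] at h1
    rw [show (i : ℤ) + 1 - (m + 1 + 1) = i - m - 1 by ring, zpow_sub₀ hp, hx] at h2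
    rw [zpow_add₀ hp (m : ℤ) 1] at h0 h1
    rw [zpow_add₀ hp ((m : ℤ) + 1) 1, zpow_add₀ hp (m : ℤ) 1] at h2
    simp only [add_sub_cancel_right, zpow_natCast, zpow_one] at h0 h1 h2
    have e : ((m + 2 : ℕ) : ℤ) = (m : ℤ) + 1 + 1 := by push_cast; ring
    simp only [upCoeff, diagCoeff, e, Nat.cast_add, Nat.cast_one, Nat.choose_succ_succ',
      Nat.choose_one_right, Nat.choose_zero_right, h0, Nat.reduceAdd]
    generalize gaussBinom p i ((m : ℤ) + 1 + 1) = w at *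
    generalize gaussBinom p i ((m : ℤ) + 1) = v at *
    generalize gaussBinom p i (m : ℤ) = t at *
    rw [show 2 * (m + 1) + 1 = m + m + 3 by ring, show 2 * i + 1 = i + i + 1 by ring,
      show 2 * m + 1 = m + m + 1 by ring]
    simp only [pow_add, pow_one]
    generalize p ^ (m.choose 2) = r at *
    generalize p ^ i = y at *
    generalize p ^ m = x at *
    field_simp at h1 h2 ⊢
    linear_combination (-(y * r * x * (1 - x * p ^ 2))) * h2 - r * (1 - p * x * y) * h1

/-- The coefficient of `y ^ k` minus that of `y ^ (k + 1)` in `φᵢ (y + 2 + y⁻¹)`, where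
`p = β ^ 2` and `φᵢ` are the polynomials of `upCoeff`. The base is parametrized by its square root
`β` so that the exponent `k * (k - 1) / 2` of `p` needs no division. -/
def laurentCoeff (β : K) (i : ℕ) (k : ℤ) : K :=
  β ^ (k * (k - 1)) * (gaussBinom (β ^ 2) (2 * i) (i - k) -
    (β ^ 2) ^ (2 * k + 1) * gaussBinom (β ^ 2) (2 * i) (i - (k + 1)))

/-- The sequence is antisymmetric under `k ↦ -1 - k`; this is the boundary value that a sequence
indexed by natural numbers needs. -/
theorem laurentCoeff_neg_one {β : K} (hβ : β ≠ 0) (i : ℕ) :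
    laurentCoeff β i (-1) = -laurentCoeff β i 0 := by
  have h := gaussBinom_symm (pow_ne_zero 2 hβ) (2 * i) ((i : ℤ) + 1)
  rw [show ((2 * i : ℕ) : ℤ) - (i + 1) = i - 1 by push_cast; ring] at h
  have e : β ^ ((-1 : ℤ) * (-1 - 1)) = β ^ 2 := by norm_num
  have e2 : (β ^ 2) ^ (2 * (-1 : ℤ) + 1) = (β ^ 2)⁻¹ := by norm_num
  rw [laurentCoeff, laurentCoeff, e, e2, sub_neg_eq_add, h]
  field_simp
  norm_num

/-- Multiplication of `φᵢ (y + 2 + y⁻¹)` by `(1 - p ^ i) ^ 2 + p ^ i * (y + 2 + y⁻¹)`, read off on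
coefficients. -/
theorem laurentCoeff_succ {β : K} (hβ : β ≠ 0) (i : ℕ) (k : ℤ) :
    laurentCoeff β (i + 1) k = (1 - (β ^ 2) ^ i) ^ 2 * laurentCoeff β i k +
      (β ^ 2) ^ i * (laurentCoeff β i (k - 1) + 2 * laurentCoeff β i k +
        laurentCoeff β i (k + 1)) := by
  have hp : β ^ 2 ≠ 0 := pow_ne_zero 2 hβ
  have h1 := gaussBinom_add_two hp i k
  have h2 := gaussBinom_add_two hp i (k + 1)
  have h3 := one_sub_mul_gaussBinom hp (2 * i) (i - k)
  have e1 : β ^ ((k - 1) * (k - 1 - 1)) = β ^ (k * (k - 1)) * (β ^ 2 / (β ^ 2) ^ k) := by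
    rw [← zpow_natCast β 2, ← zpow_mul, ← zpow_sub₀ hβ, ← zpow_add₀ hβ]
    congr 1; push_cast; ring
  have e2 : β ^ ((k + 1) * (k + 1 - 1)) = β ^ (k * (k - 1)) * (β ^ 2) ^ k := by
    rw [← zpow_natCast β 2, ← zpow_mul, ← zpow_add₀ hβ]
    congr 1; push_cast; ring
  simp only [laurentCoeff]
  rw [e1, e2, h1, h2]
  rw [show ((2 * i : ℕ) : ℤ) + 1 - (i - k) = i + k + 1 by push_cast; ring,
    show (i : ℤ) - k - 1 = i - (k + 1) by ring] at h3
  rw [add_sub_cancel_right, sub_add_cancel]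
  generalize β ^ (k * (k - 1)) = r at *
  generalize gaussBinom (β ^ 2) (2 * i) (i - (k - 1)) = a at *
  generalize gaussBinom (β ^ 2) (2 * i) (i - k) = b at *
  generalize gaussBinom (β ^ 2) (2 * i) (i - (k + 1)) = c at *
  generalize gaussBinom (β ^ 2) (2 * i) (i - (k + 1 + 1)) = d at *
  generalize β ^ 2 = p at *
  have hi : p ^ i ≠ 0 := pow_ne_zero _ hp
  have hk : p ^ k ≠ 0 := zpow_ne_zero _ hp
  simp only [two_mul, mul_add, zpow_add₀ hp, zpow_sub₀ hp, zpow_one, zpow_natCast, mul_one] at h3 ⊢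
  generalize p ^ i = y at *
  generalize p ^ k = x at *
  field_simp at h3 ⊢
  linear_combination (-(r * y * x * (p - 1))) * h3

end Ladder

/-! ### The finite Jacobi triple product and the closed formula -/

section Jacobi

variable {K : Type*} [Field K]

theorem sum_Icc_neg_succ {M : Type*} [AddCommMonoid M] (f : ℤ → M) (N : ℕ) :
    ∑ j ∈ Finset.Icc (-((N + 1 : ℕ) : ℤ)) ((N + 1 : ℕ) : ℤ), f j =
      ∑ j ∈ Finset.Icc (-(N : ℤ)) N, f j + f (N + 1) + f (-(N + 1)) := by
  have h : Finset.Icc (-((N + 1 : ℕ) : ℤ)) ((N + 1 : ℕ) : ℤ) =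
      insert (-((N : ℤ) + 1)) (insert ((N : ℤ) + 1) (Finset.Icc (-(N : ℤ)) N)) := by
    ext x
    simp only [Finset.mem_Icc, Finset.mem_insert]
    push_cast
    omega
  rw [h, Finset.sum_insert, Finset.sum_insert]
  · rw [add_comm, add_comm (f (N + 1))]
  · simp
  · simp only [Finset.mem_insert, Finset.mem_Icc, not_or]
    omega

theorem sum_Icc_neg_shift (f : ℤ → K) (N : ℕ) :
    ∑ j ∈ Finset.Icc (-(N : ℤ)) N, f (j - 1) =
      ∑ j ∈ Finset.Icc (-(N : ℤ)) N, f j + f (-(N + 1)) - f N := by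
  induction N with
  | zero => simp
  | succ N ih =>
    rw [sum_Icc_neg_succ (fun j => f (j - 1)), sum_Icc_neg_succ f, ih]
    push_cast
    rw [add_sub_cancel_right, show (-((N : ℤ) + 1) - 1) = -(N + 1 + 1) by ring]
    ring

theorem sum_Icc_neg_shift' (f : ℤ → K) (N : ℕ) :
    ∑ j ∈ Finset.Icc (-(N : ℤ)) N, f (j + 1) =
      ∑ j ∈ Finset.Icc (-(N : ℤ)) N, f j + f (N + 1) - f (-N) := by
  have h := sum_Icc_neg_shift (fun j => f (j + 1)) N
  simp only [sub_add_cancel] at h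
  rw [h, show -((N : ℤ) + 1) + 1 = -N by ring]
  ring

/-- The finite form of the Jacobi triple product, with base `β ^ 2`. -/
theorem prod_eq_sum_gaussBinom {α β : K} (hα : α ≠ 0) (hβ : β ≠ 0) (i : ℕ) : ∀ N : ℕ, i ≤ N →
    ∏ l ∈ Finset.range i, (1 - (β ^ 2) ^ l * (β * (α + α⁻¹)) + (β ^ 2) ^ (2 * l + 1)) =
      ∑ j ∈ Finset.Icc (-(N : ℤ)) N,
        (-α) ^ j * β ^ (j ^ 2) * gaussBinom (β ^ 2) (2 * i) (i - j) := by
  have hp : β ^ 2 ≠ 0 := pow_ne_zero 2 hβ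
  induction i with
  | zero =>
    intro N _
    rw [Finset.sum_eq_single 0]
    · simp [gaussBinom]
    · intro j _ hj
      simp [gaussBinom, hj]
    · intro h
      exact absurd (Finset.mem_Icc.2 ⟨by omega, by omega⟩) h
  | succ i ih =>
    intro N hN
    -- The two new factors multiply a Laurent polynomial in `α` by
    -- `1 + p ^ (2 * i + 1) - β * p ^ i * (α + α⁻¹)`, where `p = β ^ 2`.
    set t : ℤ → K := fun j => (-α) ^ j * β ^ (j ^ 2) * gaussBinom (β ^ 2) (2 * i) (i - j) with ht
    have hstep : ∀ j : ℤ, (-α) ^ j * β ^ (j ^ 2) *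
        gaussBinom (β ^ 2) (2 * (i + 1)) (((i + 1 : ℕ) : ℤ) - j) =
        (1 + (β ^ 2) ^ (2 * i + 1)) * t j - (β ^ 2) ^ i * β * α * t (j - 1) -
          (β ^ 2) ^ i * β * α⁻¹ * t (j + 1) := by
      intro j
      have hα' : -α ≠ 0 := neg_ne_zero.2 hα
      have e1 : β ^ (j ^ 2) * (β ^ 2) ^ ((i : ℤ) + 1 - j) =
          (β ^ 2) ^ i * β * β ^ ((j - 1) ^ 2) := by
        rw [← zpow_natCast (β ^ 2) i, ← zpow_natCast β 2, ← zpow_mul, ← zpow_mul, ← zpow_add₀ hβ,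
          ← zpow_add_one₀ hβ, ← zpow_add₀ hβ]
        congr 1; push_cast; ring
      have e2 : β ^ (j ^ 2) * (β ^ 2) ^ ((i : ℤ) + 1 + j) =
          (β ^ 2) ^ i * β * β ^ ((j + 1) ^ 2) := by
        rw [← zpow_natCast (β ^ 2) i, ← zpow_natCast β 2, ← zpow_mul, ← zpow_mul, ← zpow_add₀ hβ,
          ← zpow_add_one₀ hβ, ← zpow_add₀ hβ]
        congr 1; push_cast; ring
      have e3 : (β ^ 2) ^ (2 * (i : ℤ) + 1) = (β ^ 2) ^ (2 * i + 1) := by norm_cast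
      have e4 : (-α) ^ (j - 1) = (-α) ^ j * (-α)⁻¹ := zpow_sub_one₀ hα' j
      have e5 : (-α) ^ (j + 1) = (-α) ^ j * (-α) := zpow_add_one₀ hα' j
      rw [gaussBinom_add_two hp, e3]
      simp only [ht]
      rw [e4, e5]
      generalize gaussBinom (β ^ 2) (2 * i) (i - (j - 1)) = a
      generalize gaussBinom (β ^ 2) (2 * i) (i - (j + 1)) = c
      have hinv : α * (-α)⁻¹ = -1 := by field_simp
      have hinv' : α⁻¹ * (-α) = -1 := by field_simp
      linear_combination (-α) ^ j * a * e1 + (-α) ^ j * c * e2 +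
        (β ^ 2) ^ i * β * (-α) ^ j * β ^ ((j - 1) ^ 2) * a * hinv +
        (β ^ 2) ^ i * β * (-α) ^ j * β ^ ((j + 1) ^ 2) * c * hinv'
    have hz : ∀ j : ℤ, (i : ℤ) < j → t j = 0 := fun j hj => by
      simp only [ht]; rw [gaussBinom_of_neg _ _ _ (by omega), mul_zero]
    have hz' : ∀ j : ℤ, j < -(i : ℤ) → t j = 0 := fun j hj => by
      simp only [ht]; rw [gaussBinom_of_lt _ _ _ (by push_cast; omega), mul_zero]
    rw [Finset.prod_range_succ, ih N (by omega), Finset.sum_congr rfl fun j _ => hstep j,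
      Finset.sum_sub_distrib, Finset.sum_sub_distrib, ← Finset.mul_sum, ← Finset.mul_sum,
      ← Finset.mul_sum, sum_Icc_neg_shift t, sum_Icc_neg_shift' t, hz N (by omega),
      hz (N + 1) (by omega), hz' (-N) (by omega), hz' (-(N + 1)) (by omega)]
    ring

/-- Summation by parts over the symmetric intervals `[-k, k]`. -/
theorem sum_mul_sub_eq_sum_Icc (f g : ℤ → K) (hg : ∀ j, g (-j) = g j) (N : ℕ) :
    ∑ k ∈ Finset.range N, (∑ j ∈ Finset.Icc (-(k : ℤ)) k, f j) * (g k - g (k + 1)) +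
        (∑ j ∈ Finset.Icc (-(N : ℤ)) N, f j) * g N =
      ∑ j ∈ Finset.Icc (-(N : ℤ)) N, f j * g j := by
  induction N with
  | zero => simp
  | succ N ih =>
    rw [Finset.sum_range_succ, sum_Icc_neg_succ, sum_Icc_neg_succ, ← ih, hg]
    push_cast
    ring

/-- The linear functional with weights `β ^ (k * (k + 1)) * ∑_{|j| ≤ k} (-α) ^ j * β ^ (-j ^ 2)`
takes the value of a finite Jacobi triple product on `φᵢ`. -/
theorem sum_laurentCoeff {α β : K} (hα : α ≠ 0) (hβ : β ≠ 0) (i n : ℕ) (hi : i ≤ n) :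
    ∑ k ∈ Finset.range (n + 1), laurentCoeff β i k *
        (β ^ ((k : ℤ) * (k + 1)) * ∑ j ∈ Finset.Icc (-(k : ℤ)) k, (-α) ^ j * β ^ (-j ^ 2)) =
      ∏ l ∈ Finset.range i, (1 - (β ^ 2) ^ l * (β * (α + α⁻¹)) + (β ^ 2) ^ (2 * l + 1)) := by
  have hp : β ^ 2 ≠ 0 := pow_ne_zero 2 hβ
  set g : ℤ → K := fun j => β ^ (2 * j ^ 2) * gaussBinom (β ^ 2) (2 * i) (i - j) with hgdef
  have hg : ∀ j, g (-j) = g j := by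
    intro j
    simp only [hgdef]
    rw [gaussBinom_symm hp (2 * i) (i - j), neg_sq]
    congr 2; push_cast; ring
  have h := sum_mul_sub_eq_sum_Icc (fun j : ℤ => (-α) ^ j * β ^ (-j ^ 2)) g hg (n + 1)
  have hz : g ((n + 1 : ℕ) : ℤ) = 0 := by
    simp only [hgdef]; rw [gaussBinom_of_neg _ _ _ (by push_cast; omega), mul_zero]
  rw [hz, mul_zero, add_zero] at h
  rw [prod_eq_sum_gaussBinom hα hβ i (n + 1) (by omega)]
  refine Eq.trans (Finset.sum_congr rfl fun k _ => ?_) (h.trans (Finset.sum_congr rfl fun j _ => ?_))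
  · simp only [laurentCoeff, hgdef]
    have e1 : β ^ ((k : ℤ) * (k - 1)) * β ^ ((k : ℤ) * (k + 1)) = β ^ (2 * (k : ℤ) ^ 2) := by
      rw [← zpow_add₀ hβ]; congr 1; ring
    have e2 : β ^ (2 * (k : ℤ) ^ 2) * (β ^ 2) ^ (2 * (k : ℤ) + 1) =
        β ^ (2 * ((k : ℤ) + 1) ^ 2) := by
      rw [← zpow_natCast β 2, ← zpow_mul, ← zpow_add₀ hβ]; congr 1; push_cast; ring
    rw [← e2, ← e1]
    ring
  · simp only [hgdef]
    have e : β ^ (-j ^ 2) * β ^ (2 * j ^ 2) = β ^ (j ^ 2) := by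
      rw [← zpow_add₀ hβ]; congr 1; ring
    linear_combination (-α) ^ j * gaussBinom (β ^ 2) (2 * i) (i - j) * e

end Jacobi

section ClosedFormula

variable {K : Type*} [Field K]

/-- The tridiagonal operator of the constant S-fraction `1, 1, 1, …`, whose moments are the
ballot numbers, acts on the sequences `laurentCoeff β i` with the same ladder coefficients. -/
theorem jacobiOp_laurentCoeff {β : K} (hβ : β ≠ 0) (i : ℕ) :
    jacobiOp (fun _ => 1) (fun m => if m = 0 then 0 else 1) (fun k : ℕ => laurentCoeff β i k) =
      upCoeff (β ^ 2) i • (fun k : ℕ => laurentCoeff β (i + 1) k) +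
        diagCoeff (β ^ 2) i • (fun k : ℕ => laurentCoeff β i k) := by
  have hi : (β ^ 2) ^ i ≠ 0 := pow_ne_zero _ (pow_ne_zero 2 hβ)
  funext m
  simp only [Pi.add_apply, Pi.smul_apply, smul_eq_mul, upCoeff, diagCoeff]
  rw [laurentCoeff_succ hβ]
  rcases m with _ | m
  · rw [jacobiOp_zero, Nat.cast_zero, zero_sub, laurentCoeff_neg_one hβ]
    field_simp
    simp
    ring
  · rw [jacobiOp_succ]
    push_cast
    rw [add_sub_cancel_right, show (m : ℤ) + 1 + 1 = m + 2 by ring]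
    field_simp
    simp
    ring

theorem laurentCoeff_zero (β : K) :
    (fun k : ℕ => laurentCoeff β 0 k) = Pi.single 0 1 := by
  funext k
  rcases k with _ | k
  · simp [laurentCoeff, gaussBinom]
  · have h1 : -1 + -(k : ℤ) ≠ 0 := by omega
    have h2 : -1 + (-1 + -(k : ℤ)) ≠ 0 := by omega
    simp [laurentCoeff, gaussBinom, h1, h2]

/-- Ballot numbers in terms of the ladder coefficients: both sides are the moment vectors of the
constant S-fraction, expanded with `β = 1` on the left and with the given `β` on the right. -/
theorem ballot_eq_sum_connCoeff {β : K} (hβ : β ≠ 0) (n k : ℕ) :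
    ((binom (2 * n) ((n : ℤ) - k) - binom (2 * n) ((n : ℤ) - k - 1) : ℤ) : K) =
      ∑ i ∈ Finset.range (n + 1),
        connCoeff (upCoeff (β ^ 2)) (diagCoeff (β ^ 2)) n i * laurentCoeff β i k := by
  have h := pow_apply_eq_sum_connCoeff _ _ _ (fun i => fun k : ℕ => laurentCoeff β i k)
    (jacobiOp_laurentCoeff hβ) n
  -- For `β = 1` the ladder is `T vᵢ = vᵢ₊₁`, and the Gaussian binomial coefficients are ordinary.
  have hone : ∀ n : ℕ, ((jacobiOp (fun _ => (1 : K)) (fun m => if m = 0 then 0 else 1)) ^ n)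
      (fun k : ℕ => laurentCoeff 1 0 k) = fun k : ℕ => laurentCoeff 1 n k := by
    intro n
    induction n with
    | zero => rfl
    | succ n ih =>
      rw [pow_succ', Module.End.mul_apply, ih, jacobiOp_laurentCoeff one_ne_zero]
      simp [upCoeff, diagCoeff]
  rw [laurentCoeff_zero, ← laurentCoeff_zero 1, hone] at h
  have h' := congrFun h k
  rw [Finset.sum_apply] at h'
  simp only [Pi.smul_apply, smul_eq_mul] at h'
  rw [← h', laurentCoeff]
  simp [gaussBinom_one, sub_sub]

/-- The closed formula for the S-fraction with coefficients `(1 - β ^ n * α) * (1 - β ^ n / α)`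
for odd `n` and `(1 - β ^ n) ^ 2` for even `n`, over any field. -/
theorem coeff_sFraction_eq_sum {α β : K} (hα : α ≠ 0) (hβ : β ≠ 0) (n : ℕ) :
    PowerSeries.coeff n (sFraction fun m =>
        if Odd m then (1 - β ^ m * α) * (1 - β ^ m * α⁻¹) else (1 - β ^ m) ^ 2) =
      ∑ k ∈ Finset.range (n + 1),
        ((binom (2 * n) ((n : ℤ) - k) - binom (2 * n) ((n : ℤ) - k - 1) : ℤ) : K) *
          (β ^ ((k : ℤ) * (k + 1)) *
            ∑ j ∈ Finset.Icc (-(k : ℤ)) k, (-α) ^ j * β ^ (-j ^ 2)) := by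
  have hp : β ^ 2 ≠ 0 := pow_ne_zero 2 hβ
  rw [coeff_sFraction_eq_jacobiOp_pow _ (by simp)]
  have hA : (fun m : ℕ => if Odd (2 * m + 1) then
      (1 - β ^ (2 * m + 1) * α) * (1 - β ^ (2 * m + 1) * α⁻¹) else (1 - β ^ (2 * m + 1)) ^ 2) =
      fun l => 1 - (β ^ 2) ^ l * (β * (α + α⁻¹)) + (β ^ 2) ^ (2 * l + 1) := by
    funext m
    rw [if_pos (odd_two_mul_add_one m)]
    have := mul_inv_cancel₀ hα
    linear_combination β ^ (4 * m + 2) * this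
  have hC : (fun m : ℕ => if Odd (2 * m) then
      (1 - β ^ (2 * m) * α) * (1 - β ^ (2 * m) * α⁻¹) else (1 - β ^ (2 * m)) ^ 2) =
      fun l => (1 - (β ^ 2) ^ l) ^ 2 := by
    funext m
    rw [if_neg (by simp), pow_mul]
  rw [hA, hC]
  have hv := pow_apply_eq_sum_connCoeff _ _ _ _ (jacobiOp_qHahn hp (β * (α + α⁻¹))) n
  have h0 : (fun m : ℕ => ((β ^ 2) ^ (m.choose 2) * gaussBinom (β ^ 2) 0 m) *
      ∏ l ∈ Finset.Ico m 0, (1 - (β ^ 2) ^ l * (β * (α + α⁻¹)) + (β ^ 2) ^ (2 * l + 1))) =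
      Pi.single 0 1 := by
    funext m
    rcases m with _ | m
    · simp [gaussBinom]
    · have : (m : ℤ) + 1 ≠ 0 := by omega
      simp [gaussBinom, this]
  rw [h0] at hv
  rw [hv, Finset.sum_apply]
  simp only [ballot_eq_sum_connCoeff hβ, Finset.sum_mul]
  rw [Finset.sum_comm]
  refine Finset.sum_congr rfl fun i hi => ?_
  have hi' := Finset.mem_range.1 hi
  simp only [mul_assoc]
  rw [← Finset.mul_sum, sum_laurentCoeff hα hβ i n (by omega)]
  simp [gaussBinom_zero_right]

end ClosedFormula

/-- The closed formula for the moments, obtained with `α = q ^ a` and `β = q ^ b`. -/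
theorem mu_eq_sum (a b q : ℂ) (n : ℕ) (hq0 : q ≠ 0) (hq1 : q ≠ 1) :
    mu a b q n =
      1 / (1 - q) ^ (2 * n) *
        ∑ k ∈ Finset.range (n + 1),
          ((binom (2 * n) ((n : ℤ) - (k : ℤ)) - binom (2 * n) ((n : ℤ) - (k : ℤ) - 1) : ℤ) : ℂ) *
            ∑ j ∈ Finset.Icc (-(k : ℤ)) (k : ℤ),
              (-1 : ℂ) ^ j *
                q ^ (a * (j : ℂ) + b * ((k : ℂ) * ((k : ℂ) + 1) - (j : ℂ) ^ 2)) := by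
  set α := q ^ a with hαdef
  set β := q ^ b with hβdef
  have hα : α ≠ 0 := by simp [hαdef, Complex.cpow_eq_zero_iff, hq0]
  have hβ : β ≠ 0 := by simp [hβdef, Complex.cpow_eq_zero_iff, hq0]
  have hlam : lamSeq a b q = fun m => ((1 - q) ^ 2)⁻¹ *
      (if Odd m then (1 - β ^ m * α) * (1 - β ^ m * α⁻¹) else (1 - β ^ m) ^ 2) := by
    funext m
    have e : q ^ ((m : ℂ) * b) = β ^ m := by rw [mul_comm, Complex.cpow_mul_nat]
    have hq : 1 - q ≠ 0 := sub_ne_zero.2 hq1.symm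
    unfold lamSeq qNum
    simp only [if_neg hq1]
    rw [Complex.cpow_add _ _ hq0, Complex.cpow_sub _ _ hq0, e, ← hαdef]
    split_ifs
    · field_simp
    · field_simp
  rw [mu, hlam, sFraction, coeff_sTail_const_mul, ← sFraction, coeff_sFraction_eq_sum hα hβ,
    inv_pow, ← pow_mul, one_div]
  congr 1
  refine Finset.sum_congr rfl fun k _ => ?_
  congr 1
  rw [Finset.mul_sum]
  refine Finset.sum_congr rfl fun j _ => ?_
  have e : q ^ (a * (j : ℂ) + b * ((k : ℂ) * ((k : ℂ) + 1) - (j : ℂ) ^ 2)) =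
      α ^ j * β ^ ((k : ℤ) * (k + 1) - j ^ 2) := by
    rw [Complex.cpow_add _ _ hq0, Complex.cpow_mul_int]
    congr 1
    rw [← Complex.cpow_mul_int]
    congr 2
    push_cast
    ring
  rw [e, neg_eq_neg_one_mul α, mul_zpow, zpow_sub₀ hβ, zpow_neg]
  field_simp

/-! ### The exponential generating function at `q = 1` -/

section Trigonometric

variable {K : Type*} [Field K]

/-- The power series `sin (b z) / b`, which is `z` for `b = 0`. -/
def sinDivSeries (b : K) : PowerSeries K :=
  PowerSeries.mk fun n => if Even n then 0 else (-1) ^ (n / 2) * b ^ (n - 1) / (n.factorial : K)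

/-- The power series `(sin (b z) / b) ^ (2 i) / (2 i)!`. -/
def sinPow (b : K) (i : ℕ) : PowerSeries K :=
  PowerSeries.C (((2 * i).factorial : K)⁻¹) * sinDivSeries b ^ (2 * i)

theorem sinPow_zero (b : K) : sinPow b 0 = 1 := by simp [sinPow]

theorem X_pow_dvd_sinPow (b : K) (i : ℕ) :
    (PowerSeries.X : PowerSeries K) ^ (2 * i) ∣ sinPow b i := by
  refine Dvd.dvd.mul_left (pow_dvd_pow_of_dvd ?_ _) _
  rw [PowerSeries.X_dvd_iff, ← PowerSeries.coeff_zero_eq_constantCoeff_apply, sinDivSeries]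
  simp

variable [CharZero K]

/-- The power series `cos (b z)`. -/
def cosSeries (b : K) : PowerSeries K := PowerSeries.rescale b (PowerSeries.cos K)

theorem coeff_cosSeries (b : K) (n : ℕ) : PowerSeries.coeff n (cosSeries b) =
    if Even n then (-1) ^ (n / 2) * b ^ n / (n.factorial : K) else 0 := by
  rw [cosSeries, PowerSeries.coeff_rescale, PowerSeries.cos, PowerSeries.coeff_mk]
  split_ifs
  · simp only [map_div₀, map_pow, map_neg, map_one, map_natCast]
    ring
  · simp

theorem derivative_sinDivSeries (b : K) :
    PowerSeries.derivative K (sinDivSeries b) = cosSeries b := by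
  ext n
  rw [PowerSeries.coeff_derivative, sinDivSeries, PowerSeries.coeff_mk, coeff_cosSeries]
  have hn : ((n : K) + 1) ≠ 0 := by exact_mod_cast Nat.succ_ne_zero n
  have hf : ((n.factorial : ℕ) : K) ≠ 0 := by exact_mod_cast n.factorial_ne_zero
  rcases Nat.even_or_odd n with h | h
  · have h1 : ¬ Even (n + 1) := Nat.not_even_iff_odd.2 h.add_one
    have h2 : (n + 1) / 2 = n / 2 := by obtain ⟨r, hr⟩ := h; omega
    rw [if_neg h1, if_pos h, h2, Nat.factorial_succ, Nat.add_sub_cancel]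
    push_cast
    field_simp
  · rw [if_pos h.add_one, if_neg (by simpa using h), zero_mul]

theorem derivative_cosSeries (b : K) :
    PowerSeries.derivative K (cosSeries b) = -(PowerSeries.C (b ^ 2) * sinDivSeries b) := by
  ext n
  rw [PowerSeries.coeff_derivative, coeff_cosSeries, map_neg, PowerSeries.coeff_C_mul,
    sinDivSeries, PowerSeries.coeff_mk]
  have hn : ((n : K) + 1) ≠ 0 := by exact_mod_cast Nat.succ_ne_zero n
  have hf : ((n.factorial : ℕ) : K) ≠ 0 := by exact_mod_cast n.factorial_ne_zero
  rcases Nat.even_or_odd n with h | h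
  · have h1 : ¬ Even (n + 1) := Nat.not_even_iff_odd.2 h.add_one
    rw [if_neg h1, if_pos h]
    simp
  · obtain ⟨r, rfl⟩ := h
    rw [if_pos ⟨r + 1, by ring⟩, if_neg (by simp),
      show (2 * r + 1 + 1) / 2 = r + 1 by omega, show (2 * r + 1) / 2 = r by omega,
      Nat.factorial_succ, Nat.add_sub_cancel]
    push_cast at hn ⊢
    field_simp
    ring

theorem cosSeries_sq_add (b : K) :
    cosSeries b ^ 2 + PowerSeries.C (b ^ 2) * sinDivSeries b ^ 2 = 1 := by
  apply PowerSeries.derivative.ext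
  · simp only [map_add, Derivation.leibniz, PowerSeries.derivative_pow, derivative_cosSeries,
      derivative_sinDivSeries, PowerSeries.derivative_C, PowerSeries.derivative_one, smul_eq_mul]
    push_cast
    ring
  · have h1 : PowerSeries.constantCoeff (cosSeries b) = 1 := by
      rw [← PowerSeries.coeff_zero_eq_constantCoeff_apply, coeff_cosSeries]; simp
    have h2 : PowerSeries.constantCoeff (sinDivSeries b) = 0 := by
      rw [← PowerSeries.coeff_zero_eq_constantCoeff_apply, sinDivSeries]; simp
    simp [h1, h2]

theorem derivative_derivative_sinPow_succ (b : K) (i : ℕ) :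
    PowerSeries.derivative K (PowerSeries.derivative K (sinPow b (i + 1))) =
      sinPow b i - PowerSeries.C ((2 * ((i + 1 : ℕ) : K) * b) ^ 2) * sinPow b (i + 1) := by
  have hf : (((2 * i + 2).factorial : ℕ) : K)⁻¹ * ((2 * i + 2) * (2 * i + 1)) =
      (((2 * i).factorial : ℕ) : K)⁻¹ := by
    have h0 : (((2 * i).factorial : ℕ) : K) ≠ 0 := by exact_mod_cast (2 * i).factorial_ne_zero
    have h1 : ((2 * i + 1 : ℕ) : K) ≠ 0 := Nat.cast_ne_zero.2 (by omega)
    have h2 : ((2 * i + 1 + 1 : ℕ) : K) ≠ 0 := Nat.cast_ne_zero.2 (by omega)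
    rw [Nat.factorial_succ, Nat.factorial_succ]
    push_cast at h1 h2 ⊢
    field_simp
    ring
  have hC := congrArg (PowerSeries.C (R := K)) hf
  have hsq := cosSeries_sq_add b
  simp only [map_mul, map_add, map_ofNat, map_natCast, map_one] at hC
  simp only [sinPow, show 2 * (i + 1) = 2 * i + 2 by ring, Derivation.leibniz,
    PowerSeries.derivative_pow, PowerSeries.derivative_C, derivative_sinDivSeries,
    derivative_cosSeries, smul_eq_mul, mul_zero, add_zero, Nat.add_sub_cancel,
    Derivation.map_natCast, show 2 * i + 2 - 1 = 2 * i + 1 by omega]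
  simp only [map_mul, map_pow, map_natCast, map_ofNat] at hsq ⊢
  push_cast
  rw [← hC]
  generalize PowerSeries.C ((((2 * i + 2).factorial : ℕ) : K)⁻¹) = F
  linear_combination F * (2 * i + 2) * (2 * i + 1) * sinDivSeries b ^ (2 * i) * hsq

theorem derivative_derivative_cosSeries (b : K) :
    PowerSeries.derivative K (PowerSeries.derivative K (cosSeries b)) =
      -(PowerSeries.C (b ^ 2) * cosSeries b) := by
  simp [derivative_cosSeries, Derivation.leibniz, derivative_sinDivSeries]

theorem derivative_derivative_cosSeries_mul_sinPow_succ (b : K) (i : ℕ) :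
    PowerSeries.derivative K (PowerSeries.derivative K (cosSeries b * sinPow b (i + 1))) =
      cosSeries b * sinPow b i -
        PowerSeries.C ((2 * ((i + 1 : ℕ) : K) + 1) ^ 2 * b ^ 2) *
          (cosSeries b * sinPow b (i + 1)) := by
  have h1 := derivative_derivative_sinPow_succ b i
  have h2 := derivative_derivative_cosSeries b
  have h3 : sinDivSeries b * PowerSeries.derivative K (sinPow b (i + 1)) =
      2 * (i + 1) * cosSeries b * sinPow b (i + 1) := by
    simp only [sinPow, show 2 * (i + 1) = 2 * i + 2 by ring, Derivation.leibniz,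
      PowerSeries.derivative_pow, PowerSeries.derivative_C, derivative_sinDivSeries, smul_eq_mul,
      mul_zero, add_zero, show 2 * i + 2 - 1 = 2 * i + 1 by omega]
    push_cast
    ring
  have h4 : PowerSeries.derivative K (PowerSeries.derivative K
      (cosSeries b * sinPow b (i + 1))) =
      PowerSeries.derivative K (PowerSeries.derivative K (cosSeries b)) * sinPow b (i + 1) +
        2 * PowerSeries.derivative K (cosSeries b) * PowerSeries.derivative K (sinPow b (i + 1)) +
        cosSeries b * PowerSeries.derivative K (PowerSeries.derivative K (sinPow b (i + 1))) := by
    simp only [Derivation.leibniz, map_add, smul_eq_mul]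
    ring
  rw [h4, h1, h2, derivative_cosSeries]
  simp only [map_mul, map_pow, map_natCast, map_ofNat, map_add, map_one]
  push_cast
  linear_combination (-2) * PowerSeries.C b ^ 2 * h3

/-- The exponential coefficients of `sinPow b i` are the coefficients of the monomials in the
Newton basis `∏_{l < i} (X + (2 l b) ^ 2)`. -/
theorem coeff_sinPow (b : K) (m : ℕ) : ∀ i : ℕ,
    PowerSeries.coeff m (sinPow b i) =
      if Even m then connCoeff (fun _ => 1) (fun i => -(2 * (i : K) * b) ^ 2) (m / 2) i /
        (m.factorial : K) else 0 := by
  induction m using Nat.twoStepInduction with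
  | zero =>
    intro i
    rcases i with _ | i
    · simp [sinPow_zero, connCoeff]
    · have h := PowerSeries.X_pow_dvd_iff.1 (X_pow_dvd_sinPow b (i + 1)) 0 (by omega)
      rw [h]; simp [connCoeff]
  | one =>
    intro i
    rcases i with _ | i
    · simp [sinPow_zero, PowerSeries.coeff_one]
    · have h := PowerSeries.X_pow_dvd_iff.1 (X_pow_dvd_sinPow b (i + 1)) 1 (by omega)
      rw [h]; simp
  | more m ih _ =>
    intro i
    have h1 : ((m : K) + 1) ≠ 0 := by exact_mod_cast Nat.succ_ne_zero m
    have h2 : ((m : K) + 1 + 1) ≠ 0 := by exact_mod_cast Nat.succ_ne_zero (m + 1)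
    have hf : ((m.factorial : ℕ) : K) ≠ 0 := by exact_mod_cast m.factorial_ne_zero
    rcases i with _ | i
    · rw [sinPow_zero, PowerSeries.coeff_one, if_neg (by omega),
        show (m + 2) / 2 = m / 2 + 1 by omega]
      simp [connCoeff]
    · have h := congrArg (PowerSeries.coeff m) (derivative_derivative_sinPow_succ b i)
      rw [PowerSeries.coeff_derivative, PowerSeries.coeff_derivative, map_sub,
        PowerSeries.coeff_C_mul, ih, ih] at h
      rw [show (m + 2) / 2 = m / 2 + 1 by omega, Nat.factorial_succ, Nat.factorial_succ]
      push_cast at h ⊢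
      have h' : PowerSeries.coeff (m + 2) (sinPow b (i + 1)) =
          (PowerSeries.coeff (m + 2) (sinPow b (i + 1)) * (m + 1 + 1) * (m + 1)) /
            ((m + 1 + 1) * (m + 1)) := by
        field_simp
      rw [h', h]
      by_cases hm : Even m
      · rw [if_pos hm, if_pos hm, if_pos (by simpa [parity_simps] using hm)]
        simp only [connCoeff]
        push_cast
        generalize connCoeff (fun _ => (1 : K)) (fun i : ℕ => -(2 * (i : K) * b) ^ 2) (m / 2) i = s
        generalize connCoeff (fun _ => (1 : K)) (fun i : ℕ => -(2 * (i : K) * b) ^ 2) (m / 2)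
          (i + 1) = t
        field_simp
        ring
      · rw [if_neg hm, if_neg hm, if_neg (by simpa [parity_simps] using hm)]
        simp

/-- The partial sums of `∑ i, (∏_{l < i} ((2 l + 1) ^ 2 * b ^ 2 - a ^ 2)) * sinPow b i`, which is
the expansion of `cos (a z) / cos (b z)` in powers of `sin (b z) ^ 2`. -/
def secPartialSum (a b : K) (N : ℕ) : PowerSeries K :=
  ∑ i ∈ Finset.range (N + 1),
    PowerSeries.C (∏ l ∈ Finset.range i, ((2 * (l : K) + 1) ^ 2 * b ^ 2 - a ^ 2)) * sinPow b i

/-- When multiplied by `cos (b z)`, the partial sums satisfy the differential equation of `cos (a z)` up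
to a telescoped boundary term of high order. -/
theorem derivative_derivative_cosSeries_mul_secPartialSum (a b : K) (N : ℕ) :
    PowerSeries.derivative K (PowerSeries.derivative K (cosSeries b * secPartialSum a b N)) =
      -(PowerSeries.C (a ^ 2) * (cosSeries b * secPartialSum a b N)) -
        PowerSeries.C (∏ l ∈ Finset.range (N + 1), ((2 * (l : K) + 1) ^ 2 * b ^ 2 - a ^ 2)) *
          (cosSeries b * sinPow b N) := by
  induction N with
  | zero =>
    simp only [secPartialSum, zero_add, Finset.sum_range_one, Finset.prod_range_zero, map_one,
      one_mul, sinPow_zero, mul_one, derivative_derivative_cosSeries, Finset.prod_range_one,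
      Nat.cast_zero, mul_zero, one_pow, map_sub]
    ring
  | succ N ih =>
    have h : secPartialSum a b (N + 1) = secPartialSum a b N +
        PowerSeries.C (∏ l ∈ Finset.range (N + 1), ((2 * (l : K) + 1) ^ 2 * b ^ 2 - a ^ 2)) *
          sinPow b (N + 1) := Finset.sum_range_succ _ _
    have h2 := derivative_derivative_cosSeries_mul_sinPow_succ b N
    rw [h, Finset.prod_range_succ _ (N + 1)]
    generalize ∏ l ∈ Finset.range (N + 1), ((2 * (l : K) + 1) ^ 2 * b ^ 2 - a ^ 2) = r at *
    have h3 : cosSeries b * (secPartialSum a b N + PowerSeries.C r * sinPow b (N + 1)) =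
        cosSeries b * secPartialSum a b N + r • (cosSeries b * sinPow b (N + 1)) := by
      rw [PowerSeries.smul_eq_C_mul]; ring
    rw [h3, map_add, map_add, Derivation.map_smul, Derivation.map_smul, ih, h2, PowerSeries.smul_eq_C_mul,
      PowerSeries.smul_eq_C_mul]
    simp only [map_mul, map_sub]
    ring

/-- The moments of the S-fraction with coefficients `n ^ 2 * b ^ 2 - a ^ 2` for odd `n` and
`n ^ 2 * b ^ 2` for even `n`, expanded in the Newton basis. -/
theorem coeff_sFraction_eq_sum_connCoeff (a b : K) (n : ℕ) :
    PowerSeries.coeff n (sFraction fun m : ℕ =>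
        if Odd m then ((m : K) * b + a) * (m * b - a) else (m * b) ^ 2) =
      ∑ i ∈ Finset.range (n + 1), connCoeff (fun _ => 1) (fun i => -(2 * (i : K) * b) ^ 2) n i *
        ∏ l ∈ Finset.range i, ((2 * (l : K) + 1) ^ 2 * b ^ 2 - a ^ 2) := by
  rw [coeff_sFraction_eq_jacobiOp_pow _ (by simp)]
  have hA : (fun m : ℕ => if Odd (2 * m + 1) then
      (((2 * m + 1 : ℕ) : K) * b + a) * (((2 * m + 1 : ℕ) : K) * b - a)
        else (((2 * m + 1 : ℕ) : K) * b) ^ 2) =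
      fun l : ℕ => (2 * (l : K) + 1) ^ 2 * b ^ 2 - a ^ 2 := by
    funext m
    rw [if_pos (odd_two_mul_add_one m)]
    push_cast
    ring
  have hC : (fun m : ℕ => if Odd (2 * m) then
      (((2 * m : ℕ) : K) * b + a) * (((2 * m : ℕ) : K) * b - a) else (((2 * m : ℕ) : K) * b) ^ 2) =
      fun l : ℕ => (2 * (l : K) * b) ^ 2 := by
    funext m
    rw [if_neg (by simp)]
    push_cast
    ring
  rw [hA, hC]
  have hv := pow_apply_eq_sum_connCoeff _ _ _ _ (jacobiOp_mul_prod
    (fun l : ℕ => (2 * (l : K) + 1) ^ 2 * b ^ 2 - a ^ 2) (fun l : ℕ => (2 * (l : K) * b) ^ 2)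
    (fun _ => 1) (fun i => -(2 * (i : K) * b) ^ 2) (fun i m => (i.choose m : K))
    (fun i m h => by simp [Nat.choose_eq_zero_of_lt h])
    (fun i => by simp)
    (fun i => by simp; ring)
    (fun i m h => by
      have h1 : ((i.choose (m + 1) : ℕ) : K) * (m + 1) = (i.choose m : ℕ) * (i - m) := by
        have := congrArg (Nat.cast (R := K)) (Nat.choose_succ_right_eq i m)
        rwa [Nat.cast_mul, Nat.cast_mul, Nat.cast_sub h.le, Nat.cast_add, Nat.cast_one] at this
      have h2 : ((i.choose (m + 2) : ℕ) : K) * (m + 2) = (i.choose (m + 1) : ℕ) * (i - m - 1) := by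
        have := congrArg (Nat.cast (R := K)) (Nat.choose_succ_right_eq i (m + 1))
        rw [Nat.cast_mul, Nat.cast_mul, Nat.cast_sub h] at this
        push_cast at this
        linear_combination this
      simp only [Nat.choose_succ_succ']
      push_cast
      linear_combination (-4 * b ^ 2 * (m + 2)) * h2 - (4 * b ^ 2 * (i + m + 1)) * h1)) n
  have h0 : (fun m : ℕ => ((0 : ℕ).choose m : K) *
      ∏ l ∈ Finset.Ico m 0, ((2 * (l : K) + 1) ^ 2 * b ^ 2 - a ^ 2)) = Pi.single 0 1 := by
    funext m
    rcases m with _ | m <;> simp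
  rw [h0] at hv
  rw [hv, Finset.sum_apply]
  simp

theorem coeff_secPartialSum (a b : K) (N m : ℕ) (hm : m ≤ N) :
    PowerSeries.coeff m (secPartialSum a b N) =
      if Even m then PowerSeries.coeff (m / 2) (sFraction fun m : ℕ =>
        if Odd m then ((m : K) * b + a) * (m * b - a) else (m * b) ^ 2) / (m.factorial : K)
      else 0 := by
  simp only [secPartialSum, map_sum, PowerSeries.coeff_C_mul, coeff_sinPow]
  split_ifs with h
  · rw [coeff_sFraction_eq_sum_connCoeff, Finset.sum_div]
    symm
    refine Finset.sum_subset_zero_on_sdiff (Finset.range_mono (by omega)) (fun i hi => ?_)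
      (fun i _ => by ring)
    simp only [Finset.mem_sdiff, Finset.mem_range] at hi
    rw [connCoeff_eq_zero _ _ _ _ (by omega)]
    simp
  · simp

theorem coeff_cosSeries_mul_secPartialSum (a b : K) (N m : ℕ) : m ≤ N →
    PowerSeries.coeff m (cosSeries b * secPartialSum a b N) =
      PowerSeries.coeff m (cosSeries a) := by
  induction m using Nat.twoStepInduction with
  | zero =>
    intro hN
    have h := coeff_secPartialSum a b N 0 hN
    rw [PowerSeries.coeff_mul]
    simp [h, coeff_cosSeries, sFraction, coeff_zero_sTail]
  | one =>
    intro hN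
    have h := coeff_secPartialSum a b N 1 hN
    rw [PowerSeries.coeff_mul, Finset.Nat.antidiagonal_succ]
    simp [h, coeff_cosSeries]
  | more m ih _ =>
    intro hN
    -- Both sides satisfy the equation `y'' = -a ^ 2 * y` up to order `m`.
    have h := congrArg (PowerSeries.coeff m)
      (derivative_derivative_cosSeries_mul_secPartialSum a b N)
    have hz : PowerSeries.coeff m (cosSeries b * sinPow b N) = 0 :=
      PowerSeries.X_pow_dvd_iff.1 ((X_pow_dvd_sinPow b N).mul_left _) m (by omega)
    have h' := congrArg (PowerSeries.coeff m) (derivative_derivative_cosSeries a)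
    rw [map_sub, map_neg, PowerSeries.coeff_C_mul, PowerSeries.coeff_C_mul, hz, mul_zero, sub_zero,
      ih (by omega), ← PowerSeries.coeff_C_mul, ← map_neg, ← h'] at h
    simp only [PowerSeries.coeff_derivative] at h
    have h1 : ((m : K) + 1) ≠ 0 := by exact_mod_cast Nat.succ_ne_zero m
    have h2 : (((m + 1 : ℕ) : K) + 1) ≠ 0 := by exact_mod_cast Nat.succ_ne_zero (m + 1)
    exact mul_right_cancel₀ h2 (mul_right_cancel₀ h1 h)

end Trigonometric

/-- The exponential generating function of the moments at `q = 1`. -/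
theorem egf_mu_one (a b : ℂ) :
    (PowerSeries.mk fun m : ℕ => if Even m then mu a b 1 (m / 2) / (m.factorial : ℂ) else 0) =
      PowerSeries.rescale a (PowerSeries.cos ℂ) *
        (PowerSeries.rescale b (PowerSeries.cos ℂ))⁻¹ := by
  have hc : PowerSeries.constantCoeff (PowerSeries.rescale b (PowerSeries.cos ℂ)) ≠ 0 := by
    have h := coeff_cosSeries b 0
    rw [cosSeries, PowerSeries.coeff_zero_eq_constantCoeff_apply] at h
    rw [h]; simp
  rw [PowerSeries.eq_mul_inv_iff_mul_eq hc]
  have hlam : lamSeq a b 1 = fun m : ℕ =>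
      if Odd m then ((m : ℂ) * b + a) * (m * b - a) else (m * b) ^ 2 := by
    funext m
    simp [lamSeq, qNum]
  ext m
  change _ = PowerSeries.coeff m (cosSeries a)
  rw [← coeff_cosSeries_mul_secPartialSum a b m m le_rfl, mul_comm, ← cosSeries,
    PowerSeries.coeff_mul, PowerSeries.coeff_mul]
  refine Finset.sum_congr rfl fun ij hij => ?_
  have h := Finset.HasAntidiagonal.mem_antidiagonal.1 hij
  rw [coeff_secPartialSum a b m ij.2 (by omega), PowerSeries.coeff_mk, mu, hlam]

/-! ### Polynomiality and nonnegativity -/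

theorem qNum_natCast (q : ℂ) (m : ℕ) :
    qNum q (m : ℂ) =
      ((∑ i ∈ Finset.range m, (X : ℕ[X]) ^ i).map (Nat.castRingHom ℂ)).eval q := by
  rw [Polynomial.map_sum, Polynomial.eval_finsetSum]
  simp only [Polynomial.map_pow, Polynomial.map_X, Polynomial.eval_pow, Polynomial.eval_X]
  unfold qNum
  split_ifs with h
  · simp [h]
  · rw [Complex.cpow_natCast, geom_sum_eq h, ← neg_sub, ← neg_sub q, neg_div_neg_eq]

/-- The coefficients of a tail of an S-fraction are polynomials with nonnegative coefficients in
the partial numerators. -/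
theorem exists_coeff_sTail_eq_eval (lam : ℂ → ℕ → ℂ)
    (h : ∀ m : ℕ, 1 ≤ m → ∃ P : ℕ[X], ∀ q : ℂ, lam q m = (P.map (Nat.castRingHom ℂ)).eval q)
    (n : ℕ) : ∀ m : ℕ, 1 ≤ m → ∃ P : ℕ[X], ∀ q : ℂ,
      PowerSeries.coeff n (sTail (lam q) m) = (P.map (Nat.castRingHom ℂ)).eval q := by
  induction n using Nat.strong_induction_on with
  | _ n ih =>
    intro m hm
    rcases n with _ | n
    · exact ⟨1, fun q => by simp [coeff_zero_sTail]⟩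
    · obtain ⟨L, hL⟩ := h m hm
      have hP : ∀ i : ℕ, ∃ P : ℕ[X], i < n + 1 → ∀ q : ℂ,
          PowerSeries.coeff i (sTail (lam q) m) = (P.map (Nat.castRingHom ℂ)).eval q := by
        intro i
        by_cases hi : i < n + 1
        · exact (ih i hi m hm).imp fun P hP _ => hP
        · exact ⟨0, fun h => absurd h hi⟩
      have hQ : ∀ i : ℕ, ∃ P : ℕ[X], i < n + 1 → ∀ q : ℂ,
          PowerSeries.coeff i (sTail (lam q) (m + 1)) = (P.map (Nat.castRingHom ℂ)).eval q := by
        intro i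
        by_cases hi : i < n + 1
        · exact (ih i hi (m + 1) (by omega)).imp fun P hP _ => hP
        · exact ⟨0, fun h => absurd h hi⟩
      choose P hP using hP
      choose Q hQ using hQ
      refine ⟨L * ∑ ij ∈ Finset.HasAntidiagonal.antidiagonal n, P ij.1 * Q ij.2, fun q => ?_⟩
      rw [coeff_succ_sTail, hL, Polynomial.map_mul, Polynomial.eval_mul, Polynomial.map_sum,
        Polynomial.eval_finsetSum]
      congr 1
      refine Finset.sum_congr rfl fun ij hij => ?_
      have h := Finset.HasAntidiagonal.mem_antidiagonal.1 hij
      rw [hP ij.1 (by omega), hQ ij.2 (by omega), Polynomial.map_mul, Polynomial.eval_mul]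

theorem exists_natCast_eq {x : ℝ} (hx : 0 ≤ x) (h : ∃ t : ℤ, x = t) : ∃ m : ℕ, x = m := by
  obtain ⟨t, rfl⟩ := h
  obtain ⟨m, rfl⟩ := Int.eq_ofNat_of_zero_le (Int.cast_nonneg_iff.1 hx)
  exact ⟨m, by simp⟩

theorem exists_lamSeq_eq_eval {a b : ℝ} (ha : 0 ≤ a) (hab : a < b)
    (h : (∃ r s : ℤ, a = (r : ℝ) ∧ b = (s : ℝ)) ∨
      (∃ r s : ℤ, a = (r : ℝ) + 1 / 2 ∧ b = (s : ℝ) + 1 / 2)) (n : ℕ) (hn : 1 ≤ n) :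
    ∃ P : ℕ[X], ∀ q : ℂ, lamSeq a b q n = (P.map (Nat.castRingHom ℂ)).eval q := by
  have hn' : (1 : ℝ) ≤ n := by exact_mod_cast hn
  have hb : b ≤ n * b := by nlinarith
  rcases Nat.even_or_odd n with hev | hodd
  · obtain ⟨u, hu⟩ : ∃ u : ℕ, (n : ℝ) * b = u := by
      apply exists_natCast_eq (by linarith)
      obtain ⟨t, rfl⟩ := hev
      rcases h with ⟨r, s, rfl, rfl⟩ | ⟨r, s, rfl, rfl⟩
      · exact ⟨(t + t) * s, by push_cast; ring⟩
      · exact ⟨(t + t) * s + t, by push_cast; ring⟩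
    have hu' : (n : ℂ) * (b : ℂ) = u := by exact_mod_cast congrArg Complex.ofReal hu
    refine ⟨(∑ i ∈ Finset.range u, X ^ i) ^ 2, fun q => ?_⟩
    rw [lamSeq, if_neg (Nat.not_odd_iff_even.2 hev), hu', qNum_natCast, Polynomial.map_pow,
      Polynomial.eval_pow]
  · obtain ⟨u, hu⟩ : ∃ u : ℕ, (n : ℝ) * b + a = u := by
      apply exists_natCast_eq (by linarith)
      obtain ⟨t, rfl⟩ := hodd
      rcases h with ⟨r, s, rfl, rfl⟩ | ⟨r, s, rfl, rfl⟩
      · exact ⟨(2 * t + 1) * s + r, by push_cast; ring⟩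
      · exact ⟨(2 * t + 1) * s + t + r + 1, by push_cast; ring⟩
    obtain ⟨v, hv⟩ : ∃ v : ℕ, (n : ℝ) * b - a = v := by
      apply exists_natCast_eq (by linarith)
      obtain ⟨t, rfl⟩ := hodd
      rcases h with ⟨r, s, rfl, rfl⟩ | ⟨r, s, rfl, rfl⟩
      · exact ⟨(2 * t + 1) * s - r, by push_cast; ring⟩
      · exact ⟨(2 * t + 1) * s + t - r, by push_cast; ring⟩
    have hu' : (n : ℂ) * (b : ℂ) + a = u := by exact_mod_cast congrArg Complex.ofReal hu
    have hv' : (n : ℂ) * (b : ℂ) - a = v := by exact_mod_cast congrArg Complex.ofReal hv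
    refine ⟨(∑ i ∈ Finset.range u, X ^ i) * ∑ i ∈ Finset.range v, X ^ i, fun q => ?_⟩
    rw [lamSeq, if_pos hodd, hu', hv', qNum_natCast, qNum_natCast, Polynomial.map_mul,
      Polynomial.eval_mul]

end TouchardRiordan

end

theorem mainTheorem4 :
    -- the closed formula
    (∀ (a b q : ℂ) (n : ℕ), q ≠ 0 → q ≠ 1 →
      TouchardRiordan.mu a b q n =
        1 / (1 - q) ^ (2 * n) *
          ∑ k ∈ Finset.range (n + 1),
            ((TouchardRiordan.binom (2 * n) ((n : ℤ) - (k : ℤ))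
                - TouchardRiordan.binom (2 * n) ((n : ℤ) - (k : ℤ) - 1) : ℤ) : ℂ) *
              ∑ j ∈ Finset.Icc (-(k : ℤ)) (k : ℤ),
                (-1 : ℂ) ^ j *
                  q ^ (a * (j : ℂ) + b * ((k : ℂ) * ((k : ℂ) + 1) - (j : ℂ) ^ 2))) ∧
    -- the exponential generating function at `q = 1`, as a formal power series in `z`
    (∀ a b : ℂ,
      (PowerSeries.mk fun m : ℕ =>
          if Even m then TouchardRiordan.mu a b 1 (m / 2) / (m.factorial : ℂ) else 0) =
        PowerSeries.rescale a (PowerSeries.cos ℂ) *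
          (PowerSeries.rescale b (PowerSeries.cos ℂ))⁻¹) ∧
    -- polynomiality and nonnegativity
    (∀ a b : ℝ, 0 ≤ a → a < b →
      ((∃ r s : ℤ, a = (r : ℝ) ∧ b = (s : ℝ)) ∨
        (∃ r s : ℤ, a = (r : ℝ) + 1 / 2 ∧ b = (s : ℝ) + 1 / 2)) →
      ∀ n : ℕ, ∃ P : ℕ[X], ∀ q : ℂ, q ≠ 0 →
        TouchardRiordan.mu (a : ℂ) (b : ℂ) q n = (P.map (Nat.castRingHom ℂ)).eval q) := by
  exact ⟨TouchardRiordan.mu_eq_sum, TouchardRiordan.egf_mu_one, fun a b ha hab h n =>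
    (TouchardRiordan.exists_coeff_sTail_eq_eval (fun q => TouchardRiordan.lamSeq a b q)
      (TouchardRiordan.exists_lamSeq_eq_eval ha hab h) n 1 le_rfl).imp fun _ hP q _ => hP q⟩
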